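/- A pseudocomplemented Kleene algebra is an algebra $(L,\vee,\wedge,{\sim},{}^*,0,1)$ such that $(L,\vee,\wedge,0,1)$ is a bounded distributive lattice, ${\sim}$ is a unary operation with ${\sim}{\sim}x=x$ and $x\le y\Rightarrow{\sim}y\le{\sim}x$, the inequality $x\wedge{\sim}x\le y\vee{\sim}y$ holds for all $x,y$, and $x\wedge z=0\iff z\le x^*$ for all $x,z$. Put $x^+={\sim}(({\sim}x)^*)$. The algebra is called regular if $x^*=y^*$ and $x^+=y^+$ imply $x=y$. A covering of a set $U$ is a collection $\mathcal H$ of nonempty subsets of $U$ with $\bigcup\mathcal H=U$; it is irredundant if $\mathcal H\setminus\{B\}$ is not a covering of $U$ for any $B\in\mathcal H$. The tolerance induced by $\mathcal H$ is $R=\bigcup\{B\times B\mid B\in\mathcal H\}$. With $R(x)=\{y\mid x\,R\,y\}$, let $$X^\blacktriangledown=\{x\in U\mid R(x)\subseteq X\},\qquad X^\blacktriangle=\{x\in U\mid R(x)\cap X\neq\emptyset\}\qquad(X\subseteq U)$$ and $\mathit{RS}=\{(X^\blacktriangledown,X^\blacktriangle)\mid X\subseteq U\}$, ordered by componentwise inclusion.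 If $R$ is induced by an irredundant covering of $U$, then $\mathbb{RS}=(\mathit{RS},\vee,\wedge,{\sim},{}^*,0,1)$ is a pseudocomplemented Kleene algebra, where $$\begin{aligned} (X^\blacktriangledown,X^\blacktriangle)\vee(Y^\blacktriangledown,Y^\blacktriangle)&=\big((X^\blacktriangledown\cup Y^\blacktriangledown)^{\blacktriangle\blacktriangledown},\,X^\blacktriangle\cup Y^\blacktriangle\big),\\ (X^\blacktriangledown,X^\blacktriangle)\wedge(Y^\blacktriangledown,Y^\blacktriangle)&=\big(X^\blacktriangledown\cap Y^\blacktriangledown,\,(X^\blacktriangle\cap Y^\blacktriangle)^{\blacktriangledown\blacktriangle}\big),\\ {\sim}(X^\blacktriangledown,X^\blacktriangle)&=(X^{c\blacktriangledown},X^{c\blacktriangle}),\qquad (X^\blacktriangledown,X^\blacktriangle)^*=(X^{c\blacktriangledown\blacktriangledown},X^{c\blacktriangledown\blacktriangle}),\\ 0&=(\emptyset,\emptyset),\qquad 1=(U,U). \end{aligned}$$ **Theorem.** Let $\mathbb L$ be a regular pseudocomplemented Kleene algebra. Then there exist a set $U$ and a tolerance $R$ induced by an irredundant covering of $U$ such that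 $\mathbb L$ is isomorphic to a subalgebra of $\mathbb{RS}$ (the isomorphism and the subalgebra respect all of $\vee,\wedge,{\sim},{}^*,0,1$). -/

import Mathlib

universe u

/-! ### Pseudocomplemented Kleene algebras -/

/-- A pseudocomplemented Kleene algebra `(L, ⊔, ⊓, ∼, *, ⊥, ⊤)`: a bounded distributive lattice
with a polarity `kneg` satisfying the Kleene inequality and a pseudocomplementation `pcompl`. -/
class PseudocomplementedKleeneAlgebra (L : Type u) extends DistribLattice L, BoundedOrder L where
  /-- the De Morgan (Kleene) negation `∼` -/
  kneg : L → L
  /-- the pseudocomplement `*` -/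
  pcompl : L → L
  kneg_kneg : ∀ x : L, kneg (kneg x) = x
  kneg_le_kneg : ∀ x y : L, x ≤ y → kneg y ≤ kneg x
  inf_kneg_le_sup_kneg : ∀ x y : L, x ⊓ kneg x ≤ y ⊔ kneg y
  inf_eq_bot_iff_le_pcompl : ∀ x z : L, x ⊓ z = ⊥ ↔ z ≤ pcompl x

namespace PseudocomplementedKleeneAlgebra

/-- The dual pseudocomplement `x⁺ = ∼((∼x)*)`. -/
def dualPcompl {L : Type u} [PseudocomplementedKleeneAlgebra L] (x : L) : L :=
  kneg (pcompl (kneg x))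

/-- Regularity: an element is determined by its pseudocomplement and its dual pseudocomplement. -/
def IsRegular (L : Type u) [PseudocomplementedKleeneAlgebra L] : Prop :=
  ∀ x y : L, pcompl x = pcompl y → dualPcompl x = dualPcompl y → x = y

/-- `S` is (the universe of) a subalgebra: it is closed under all operations and constants. -/
structure IsSubalgebra {A : Type u} [PseudocomplementedKleeneAlgebra A] (S : Set A) : Prop where
  sup_mem : ∀ x ∈ S, ∀ y ∈ S, x ⊔ y ∈ S
  inf_mem : ∀ x ∈ S, ∀ y ∈ S, x ⊓ y ∈ S
  kneg_mem : ∀ x ∈ S, kneg x ∈ S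
  pcompl_mem : ∀ x ∈ S, pcompl x ∈ S
  bot_mem : (⊥ : A) ∈ S
  top_mem : (⊤ : A) ∈ S

/-- The bijection `e` from `L` onto the subset `S` of `A` is an isomorphism of pseudocomplemented
Kleene algebras, where the operations on `S` are the restrictions of those of `A`. -/
structure IsIsomorphismOnto {L A : Type u} [PseudocomplementedKleeneAlgebra L]
    [PseudocomplementedKleeneAlgebra A] {S : Set A} (e : L ≃ S) : Prop where
  map_sup : ∀ x y : L, (e (x ⊔ y) : A) = (e x : A) ⊔ (e y : A)
  map_inf : ∀ x y : L, (e (x ⊓ y) : A) = (e x : A) ⊓ (e y : A)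
  map_kneg : ∀ x : L, (e (kneg x) : A) = kneg (e x : A)
  map_pcompl : ∀ x : L, (e (pcompl x) : A) = pcompl (e x : A)
  map_bot : (e ⊥ : A) = ⊥
  map_top : (e ⊤ : A) = ⊤

end PseudocomplementedKleeneAlgebra

/-! ### Rough sets of a binary relation -/

/-- The lower approximation `{x | R(x) ⊆ X}`. -/
def lowerApprox {U : Type u} (R : U → U → Prop) (X : Set U) : Set U :=
  {x | {y | R x y} ⊆ X}

/-- The upper approximation `{x | R(x) ∩ X ≠ ∅}`. -/
def upperApprox {U : Type u} (R : U → U → Prop) (X : Set U) : Set U :=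
  {x | ({y | R x y} ∩ X).Nonempty}

/-- The set `RS` of rough sets of `R`, i.e. of pairs (lower approximation, upper approximation)
of subsets of `U`. -/
def RoughSet {U : Type u} (R : U → U → Prop) : Type u :=
  {p : Set U × Set U // ∃ X : Set U, p = (lowerApprox R X, upperApprox R X)}

/-! ### Irredundant coverings and their tolerances -/

/-- A covering of `U`: a collection of nonempty subsets of `U` whose union is `U`. -/
def IsCovering {U : Type u} (H : Set (Set U)) : Prop :=
  (∀ B ∈ H, B.Nonempty) ∧ ⋃₀ H = Set.univ

/-- An irredundant covering of `U`: no member can be dropped. -/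
structure IrredundantCovering (U : Type u) where
  sets : Set (Set U)
  isCovering : IsCovering sets
  irredundant : ∀ B ∈ sets, ¬ IsCovering (sets \ {B})

/-- The tolerance `⋃ {B × B | B ∈ H}` induced by a covering `H`. -/
def IrredundantCovering.tolerance {U : Type u} (H : IrredundantCovering U) : U → U → Prop :=
  fun x y => ∃ B ∈ H.sets, x ∈ B ∧ y ∈ B

/-! ### The rough set pseudocomplemented Kleene algebra of an irredundant covering

The facts below are those needed to see that the operations are well defined and satisfy the
axioms. -/

section Approximations

theorem lowerApprox_mono {U : Type u} (R : U → U → Prop) {X Y : Set U} (h : X ⊆ Y) :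
    lowerApprox R X ⊆ lowerApprox R Y :=
  fun _ hx _ hy => h (hx hy)

theorem upperApprox_mono {U : Type u} (R : U → U → Prop) {X Y : Set U} (h : X ⊆ Y) :
    upperApprox R X ⊆ upperApprox R Y :=
  fun _ ⟨y, hy, hyX⟩ => ⟨y, hy, h hyX⟩

theorem lowerApprox_compl {U : Type u} (R : U → U → Prop) (X : Set U) :
    lowerApprox R Xᶜ = (upperApprox R X)ᶜ := by
  ext x
  constructor
  · rintro h ⟨y, hy, hyX⟩
    exact h hy hyX
  · intro h y hy hyX
    exact h ⟨y, hy, hyX⟩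

theorem upperApprox_compl {U : Type u} (R : U → U → Prop) (X : Set U) :
    upperApprox R Xᶜ = (lowerApprox R X)ᶜ := by
  rw [← compl_compl (upperApprox R Xᶜ), ← lowerApprox_compl, compl_compl]

end Approximations

namespace IrredundantCovering

variable {U : Type u} (H : IrredundantCovering U)

theorem tolerance_refl (x : U) : H.tolerance x x := by
  have hx : x ∈ ⋃₀ H.sets := by rw [H.isCovering.2]; trivial
  obtain ⟨B, hB, hxB⟩ := hx
  exact ⟨B, hB, hxB, hxB⟩

theorem tolerance_symm {x y : U} (h : H.tolerance x y) : H.tolerance y x := by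
  obtain ⟨B, hB, hx, hy⟩ := h
  exact ⟨B, hB, hy, hx⟩

theorem upper_lower_subset (X : Set U) :
    upperApprox H.tolerance (lowerApprox H.tolerance X) ⊆ X := by
  rintro x ⟨y, hxy, hy⟩
  exact hy (H.tolerance_symm hxy)

theorem subset_lower_upper (X : Set U) :
    X ⊆ lowerApprox H.tolerance (upperApprox H.tolerance X) :=
  fun x hx _ hxy => ⟨x, H.tolerance_symm hxy, hx⟩

theorem lower_upper_lower (X : Set U) :
    lowerApprox H.tolerance (upperApprox H.tolerance (lowerApprox H.tolerance X)) =
      lowerApprox H.tolerance X :=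
  Set.Subset.antisymm (lowerApprox_mono _ (H.upper_lower_subset X)) (H.subset_lower_upper _)

theorem upper_lower_upper (X : Set U) :
    upperApprox H.tolerance (lowerApprox H.tolerance (upperApprox H.tolerance X)) =
      upperApprox H.tolerance X :=
  Set.Subset.antisymm (H.upper_lower_subset _) (upperApprox_mono _ (H.subset_lower_upper X))

theorem exists_private {B : Set U} (hB : B ∈ H.sets) :
    ∃ x ∈ B, ∀ C ∈ H.sets, x ∈ C → C = B := by
  by_contra hcon
  push Not at hcon
  refine H.irredundant B hB ⟨fun C hC => H.isCovering.1 C hC.1, ?_⟩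
  rw [Set.eq_univ_iff_forall]
  intro x
  have hx : x ∈ ⋃₀ H.sets := by rw [H.isCovering.2]; trivial
  obtain ⟨C, hC, hxC⟩ := hx
  by_cases hCB : C = B
  · obtain ⟨D, hD, hxD, hne⟩ := hcon x (hCB ▸ hxC)
    exact ⟨D, ⟨hD, hne⟩, hxD⟩
  · exact ⟨C, ⟨hC, hCB⟩, hxC⟩

/-- A point that lies in exactly one member of the covering, chosen for each member. -/
noncomputable def point (B : H.sets) : U := (H.exists_private B.2).choose

theorem point_mem (B : H.sets) : H.point B ∈ B.1 := (H.exists_private B.2).choose_spec.1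

theorem eq_of_point_mem (B C : H.sets) (h : H.point B ∈ C.1) : C = B :=
  Subtype.ext ((H.exists_private B.2).choose_spec.2 C.1 C.2 h)

theorem tolerance_point (B : H.sets) (y : U) : H.tolerance (H.point B) y ↔ y ∈ B.1 := by
  constructor
  · rintro ⟨C, hC, h1, h2⟩
    have := H.eq_of_point_mem B ⟨C, hC⟩ h1
    rw [← this]
    exact h2
  · exact fun h => ⟨B.1, B.2, H.point_mem B, h⟩

theorem point_mem_lower (B : H.sets) (X : Set U) :
    H.point B ∈ lowerApprox H.tolerance X ↔ B.1 ⊆ X :=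
  ⟨fun h _ hy => h ((H.tolerance_point B _).2 hy), fun h _ hy => h ((H.tolerance_point B _).1 hy)⟩

theorem point_mem_upper (B : H.sets) (X : Set U) :
    H.point B ∈ upperApprox H.tolerance X ↔ (B.1 ∩ X).Nonempty :=
  ⟨fun ⟨y, hy, hyX⟩ => ⟨y, (H.tolerance_point B y).1 hy, hyX⟩,
    fun ⟨y, hy, hyX⟩ => ⟨y, (H.tolerance_point B y).2 hy, hyX⟩⟩

theorem mem_lower (x : U) (X : Set U) :
    x ∈ lowerApprox H.tolerance X ↔ ∀ B : H.sets, x ∈ B.1 → B.1 ⊆ X :=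
  ⟨fun h B hx _ hy => h ⟨B.1, B.2, hx, hy⟩, fun h _ ⟨B, hB, hx, hy⟩ => h ⟨B, hB⟩ hx hy⟩

theorem mem_upper (x : U) (X : Set U) :
    x ∈ upperApprox H.tolerance X ↔ ∃ B : H.sets, x ∈ B.1 ∧ (B.1 ∩ X).Nonempty :=
  ⟨fun ⟨y, ⟨B, hB, hx, hy⟩, hyX⟩ => ⟨⟨B, hB⟩, hx, y, hy, hyX⟩,
    fun ⟨B, hx, y, hy, hyX⟩ => ⟨y, ⟨B.1, B.2, hx, hy⟩, hyX⟩⟩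

/-- Prescribing which members of the covering are contained in, and which ones meet, a set. -/
theorem exists_set (T S : Set H.sets)
    (hTS : ∀ B ∈ T, ∀ C : H.sets, (B.1 ∩ C.1).Nonempty → C ∈ S)
    (hST : ∀ B ∈ S, B.1.Subsingleton → B ∈ T) :
    ∃ X : Set U, ∀ B : H.sets, (B.1 ⊆ X ↔ B ∈ T) ∧ ((B.1 ∩ X).Nonempty ↔ B ∈ S) := by
  refine ⟨{x | (∃ B ∈ T, x ∈ B.1) ∨
    ∃ B ∈ S, (∀ C ∈ T, ¬ (C.1 ∩ B.1).Nonempty) ∧ x = H.point B}, fun B => ⟨⟨?_, ?_⟩, ?_, ?_⟩⟩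
  · intro h
    rcases h (H.point_mem B) with ⟨C, hC, hm⟩ | ⟨C, hC, hdis, he⟩
    · rwa [← H.eq_of_point_mem B C hm]
    · have hBC : C = B := (H.eq_of_point_mem C B (he ▸ H.point_mem B)).symm
      subst hBC
      refine hST C hC ?_
      have key : ∀ y ∈ C.1, y = H.point C := by
        intro y hy
        rcases h hy with ⟨D, hD, hm⟩ | ⟨D, hD, -, he'⟩
        · exact absurd ⟨y, hm, hy⟩ (hdis D hD)
        · have := H.eq_of_point_mem D C (he' ▸ hy)
          rw [he', this]
      intro y hy z hz
      rw [key y hy, key z hz]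
  · exact fun h x hx => Or.inl ⟨B, h, hx⟩
  · rintro ⟨x, hx, ⟨C, hC, hm⟩ | ⟨C, hC, -, he⟩⟩
    · exact hTS C hC B ⟨x, hm, hx⟩
    · rwa [H.eq_of_point_mem C B (he ▸ hx)]
  · intro hB
    by_cases hd : ∃ C ∈ T, (C.1 ∩ B.1).Nonempty
    · obtain ⟨C, hC, x, hxC, hxB⟩ := hd
      exact ⟨x, hxB, Or.inl ⟨C, hC, hxC⟩⟩
    · push Not at hd
      refine ⟨H.point B, H.point_mem B, Or.inr ⟨B, hB, fun C hC hne => ?_, rfl⟩⟩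
      exact hne.ne_empty (hd C hC)

theorem sup_mem (X Y : Set U) : ∃ Z : Set U,
    (lowerApprox H.tolerance (upperApprox H.tolerance
        (lowerApprox H.tolerance X ∪ lowerApprox H.tolerance Y)),
      upperApprox H.tolerance X ∪ upperApprox H.tolerance Y) =
    (lowerApprox H.tolerance Z, upperApprox H.tolerance Z) := by
  obtain ⟨Z, hZ⟩ := H.exists_set {B | B.1 ⊆ X ∨ B.1 ⊆ Y}
    {B | (B.1 ∩ X).Nonempty ∨ (B.1 ∩ Y).Nonempty}
    (by
      rintro B (h | h) C ⟨x, hB, hC⟩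
      · exact Or.inl ⟨x, hC, h hB⟩
      · exact Or.inr ⟨x, hC, h hB⟩)
    (by
      rintro B (⟨x, hB, hx⟩ | ⟨x, hB, hx⟩) hs
      · exact Or.inl fun y hy => hs hB hy ▸ hx
      · exact Or.inr fun y hy => hs hB hy ▸ hx)
  have hup : upperApprox H.tolerance
      (lowerApprox H.tolerance X ∪ lowerApprox H.tolerance Y) ⊆ Z := by
    rintro x ⟨y, ⟨C, hC, hxC, hyC⟩, hy | hy⟩
    · exact (hZ ⟨C, hC⟩).1.2 (Or.inl ((H.mem_lower y X).1 hy ⟨C, hC⟩ hyC)) hxC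
    · exact (hZ ⟨C, hC⟩).1.2 (Or.inr ((H.mem_lower y Y).1 hy ⟨C, hC⟩ hyC)) hxC
  refine ⟨Z, Prod.ext (Set.Subset.antisymm (lowerApprox_mono _ hup) ?_) ?_⟩
  · intro x hx
    rw [H.mem_lower] at hx ⊢
    intro B hxB y hyB
    refine ⟨H.point B, ⟨B.1, B.2, hyB, H.point_mem B⟩, ?_⟩
    rcases (hZ B).1.1 (hx B hxB) with h | h
    · exact Or.inl ((H.point_mem_lower B X).2 h)
    · exact Or.inr ((H.point_mem_lower B Y).2 h)
  · ext x
    simp only [Set.mem_union, H.mem_upper, (hZ _).2, Set.mem_ofPred_eq, ← exists_or, ← and_or_left]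

theorem inf_mem (X Y : Set U) : ∃ Z : Set U,
    (lowerApprox H.tolerance X ∩ lowerApprox H.tolerance Y,
      upperApprox H.tolerance (lowerApprox H.tolerance
        (upperApprox H.tolerance X ∩ upperApprox H.tolerance Y))) =
    (lowerApprox H.tolerance Z, upperApprox H.tolerance Z) := by
  obtain ⟨Z, hZ⟩ := H.sup_mem Xᶜ Yᶜ
  obtain ⟨h1, h2⟩ := Prod.mk.inj hZ
  refine ⟨Zᶜ, Prod.ext ?_ ?_⟩
  · simp only [lowerApprox_compl]
    rw [← h2, upperApprox_compl, upperApprox_compl, Set.compl_union, compl_compl, compl_compl]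
  · simp only [upperApprox_compl]
    rw [← h1, lowerApprox_compl, lowerApprox_compl, ← Set.compl_inter, upperApprox_compl,
      lowerApprox_compl, compl_compl]

theorem kneg_mem {p : Set U × Set U}
    (hp : ∃ X, p = (lowerApprox H.tolerance X, upperApprox H.tolerance X)) :
    ∃ X, (p.2ᶜ, p.1ᶜ) = (lowerApprox H.tolerance X, upperApprox H.tolerance X) := by
  obtain ⟨X, rfl⟩ := hp
  exact ⟨Xᶜ, by rw [lowerApprox_compl, upperApprox_compl]⟩

theorem bot_mem : ∃ X : Set U,
    ((∅, ∅) : Set U × Set U) = (lowerApprox H.tolerance X, upperApprox H.tolerance X) := by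
  refine ⟨∅, Prod.ext ?_ ?_⟩
  · ext x
    exact ⟨fun h => h.elim, fun h => h (H.tolerance_refl x)⟩
  · ext x
    exact ⟨fun h => h.elim, fun ⟨_, _, h⟩ => h.elim⟩

theorem top_mem : ∃ X : Set U,
    ((Set.univ, Set.univ) : Set U × Set U) =
      (lowerApprox H.tolerance X, upperApprox H.tolerance X) := by
  refine ⟨Set.univ, Prod.ext ?_ ?_⟩
  · ext x
    exact ⟨fun _ _ _ => trivial, fun _ => trivial⟩
  · ext x
    exact ⟨fun _ => ⟨x, H.tolerance_refl x, trivial⟩, fun _ => trivial⟩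

/-- Rough sets are ordered by componentwise inclusion. -/
instance : PartialOrder (RoughSet H.tolerance) where
  le p q := p.1.1 ⊆ q.1.1 ∧ p.1.2 ⊆ q.1.2
  le_refl _ := ⟨subset_rfl, subset_rfl⟩
  le_trans _ _ _ h h' := ⟨h.1.trans h'.1, h.2.trans h'.2⟩
  le_antisymm _ _ h h' := Subtype.ext (Prod.ext (h.1.antisymm h'.1) (h.2.antisymm h'.2))

/-- The lattice of rough sets:
`(A, B) ⊔ (A', B') = ((A ∪ A')^▲▼, B ∪ B')` and `(A, B) ⊓ (A', B') = (A ∩ A', (B ∩ B')^▼▲)`. -/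
instance : Lattice (RoughSet H.tolerance) where
  sup p q := ⟨(lowerApprox H.tolerance (upperApprox H.tolerance (p.1.1 ∪ q.1.1)), p.1.2 ∪ q.1.2), by
    obtain ⟨_, X, rfl⟩ := p
    obtain ⟨_, Y, rfl⟩ := q
    exact H.sup_mem X Y⟩
  inf p q := ⟨(p.1.1 ∩ q.1.1, upperApprox H.tolerance (lowerApprox H.tolerance (p.1.2 ∩ q.1.2))), by
    obtain ⟨_, X, rfl⟩ := p
    obtain ⟨_, Y, rfl⟩ := q
    exact H.inf_mem X Y⟩
  le_sup_left p q :=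
    ⟨Set.subset_union_left.trans (H.subset_lower_upper _), Set.subset_union_left⟩
  le_sup_right p q :=
    ⟨Set.subset_union_right.trans (H.subset_lower_upper _), Set.subset_union_right⟩
  sup_le p q r hp hq := by
    obtain ⟨_, X, rfl⟩ := r
    refine ⟨?_, Set.union_subset hp.2 hq.2⟩
    have := lowerApprox_mono H.tolerance
      (upperApprox_mono H.tolerance (Set.union_subset hp.1 hq.1))
    simpa only [H.lower_upper_lower] using this
  inf_le_left p q :=
    ⟨Set.inter_subset_left, (H.upper_lower_subset _).trans Set.inter_subset_left⟩
  inf_le_right p q :=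
    ⟨Set.inter_subset_right, (H.upper_lower_subset _).trans Set.inter_subset_right⟩
  le_inf p q r hq hr := by
    obtain ⟨_, X, rfl⟩ := p
    refine ⟨Set.subset_inter hq.1 hr.1, ?_⟩
    have := upperApprox_mono H.tolerance
      (lowerApprox_mono H.tolerance (Set.subset_inter hq.2 hr.2))
    simpa only [H.upper_lower_upper] using this

theorem le_of_point {p q : RoughSet H.tolerance}
    (h1 : ∀ B : H.sets, H.point B ∈ p.1.1 → H.point B ∈ q.1.1)
    (h2 : ∀ B : H.sets, H.point B ∈ p.1.2 → H.point B ∈ q.1.2) : p ≤ q := by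
  obtain ⟨_, X, rfl⟩ := p
  obtain ⟨_, Y, rfl⟩ := q
  simp only [H.point_mem_lower, H.point_mem_upper] at h1 h2
  constructor
  · intro x hx
    rw [H.mem_lower] at hx ⊢
    exact fun B hB => h1 B (hx B hB)
  · intro x hx
    rw [H.mem_upper] at hx ⊢
    obtain ⟨B, hB, hne⟩ := hx
    exact ⟨B, hB, h2 B hne⟩

theorem point_mem_sup_fst (p q : RoughSet H.tolerance) (B : H.sets) :
    H.point B ∈ (p ⊔ q).1.1 ↔ H.point B ∈ p.1.1 ∨ H.point B ∈ q.1.1 := by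
  refine ⟨fun h => ?_, fun h => H.subset_lower_upper _ h⟩
  obtain ⟨_, X, rfl⟩ := p
  obtain ⟨_, Y, rfl⟩ := q
  obtain ⟨z, hz, hzu⟩ := (H.point_mem_lower B _).1 h (H.point_mem B)
  replace hz := (H.tolerance_point B z).1 hz
  rcases hzu with hzu | hzu
  · exact Or.inl ((H.point_mem_lower B X).2 ((H.mem_lower z X).1 hzu B hz))
  · exact Or.inr ((H.point_mem_lower B Y).2 ((H.mem_lower z Y).1 hzu B hz))

theorem point_mem_inf_snd (p q : RoughSet H.tolerance) (B : H.sets) :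
    H.point B ∈ (p ⊓ q).1.2 ↔ H.point B ∈ p.1.2 ∧ H.point B ∈ q.1.2 := by
  refine ⟨fun h => H.upper_lower_subset _ h, fun h => ?_⟩
  obtain ⟨_, X, rfl⟩ := p
  obtain ⟨_, Y, rfl⟩ := q
  refine (H.point_mem_upper B _).2 ⟨H.point B, H.point_mem B, (H.point_mem_lower B _).2 ?_⟩
  intro y hy
  exact ⟨(H.mem_upper y X).2 ⟨B, hy, (H.point_mem_upper B X).1 h.1⟩,
    (H.mem_upper y Y).2 ⟨B, hy, (H.point_mem_upper B Y).1 h.2⟩⟩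

/-- The rough set pseudocomplemented Kleene algebra: `∼(A, B) = (Bᶜ, Aᶜ)`,
`(A, B)* = (Bᶜ^▼, Bᶜ^▲)`, `0 = (∅, ∅)` and `1 = (U, U)`. If `(A, B) = (X^▼, X^▲)`, these are
`∼(A, B) = (Xᶜ^▼, Xᶜ^▲)` and `(A, B)* = (Xᶜ^▼▼, Xᶜ^▼▲)`, because `Bᶜ = Xᶜ^▼`, `Aᶜ = Xᶜ^▲`. -/
instance : PseudocomplementedKleeneAlgebra (RoughSet H.tolerance) where
  le_sup_inf p q r := by
    refine H.le_of_point (fun B h => ?_) (fun B h => ?_)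
    · rw [H.point_mem_sup_fst]
      have h1 := (H.point_mem_sup_fst p q B).1 h.1
      have h2 := (H.point_mem_sup_fst p r B).1 h.2
      rcases h1 with h1 | h1
      · exact Or.inl h1
      · rcases h2 with h2 | h2
        · exact Or.inl h2
        · exact Or.inr ⟨h1, h2⟩
    · rw [H.point_mem_inf_snd] at h
      obtain ⟨h1, h2⟩ := h
      rcases h1 with h1 | h1
      · exact Or.inl h1
      · rcases h2 with h2 | h2
        · exact Or.inl h2
        · exact Or.inr ((H.point_mem_inf_snd q r B).2 ⟨h1, h2⟩)
  top := ⟨(Set.univ, Set.univ), H.top_mem⟩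
  le_top _ := ⟨Set.subset_univ _, Set.subset_univ _⟩
  bot := ⟨(∅, ∅), H.bot_mem⟩
  bot_le _ := ⟨Set.empty_subset _, Set.empty_subset _⟩
  kneg p := ⟨(p.1.2ᶜ, p.1.1ᶜ), H.kneg_mem p.2⟩
  pcompl p := ⟨(lowerApprox H.tolerance p.1.2ᶜ, upperApprox H.tolerance p.1.2ᶜ), p.1.2ᶜ, rfl⟩
  kneg_kneg p := Subtype.ext (Prod.ext (compl_compl _) (compl_compl _))
  kneg_le_kneg p q h := ⟨Set.compl_subset_compl.2 h.2, Set.compl_subset_compl.2 h.1⟩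
  inf_kneg_le_sup_kneg p q := by
    have lower_le_upper : ∀ r : RoughSet H.tolerance, r.1.1 ⊆ r.1.2 := by
      rintro ⟨_, X, rfl⟩ x hx
      exact ⟨x, H.tolerance_refl x, hx (H.tolerance_refl x)⟩
    refine ⟨fun x hx => absurd (lower_le_upper p hx.1) hx.2, fun x _ => ?_⟩
    by_cases hx : x ∈ q.1.1
    · exact Or.inl (lower_le_upper q hx)
    · exact Or.inr hx
  inf_eq_bot_iff_le_pcompl p q := by
    constructor
    · intro h
      have hdis : ∀ B : H.sets, H.point B ∈ p.1.2 → H.point B ∈ q.1.2 → False := by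
        intro B h1 h2
        have h3 := (H.point_mem_inf_snd p q B).2 ⟨h1, h2⟩
        rw [h] at h3
        exact h3
      obtain ⟨_, X, rfl⟩ := p
      obtain ⟨_, Y, rfl⟩ := q
      simp only [H.point_mem_upper] at hdis
      refine H.le_of_point (fun B hB => ?_) (fun B hB => ?_)
      · refine (H.point_mem_lower B _).2 fun y hy hyX => ?_
        obtain ⟨C, hyC, hCX⟩ := (H.mem_upper y X).1 hyX
        exact hdis C hCX ⟨y, hyC, (H.point_mem_lower B Y).1 hB hy⟩
      · refine (H.point_mem_upper B _).2 ⟨H.point B, H.point_mem B, fun hBX => ?_⟩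
        exact hdis B ((H.point_mem_upper B X).1 hBX) ((H.point_mem_upper B Y).1 hB)
    · intro h
      refine le_antisymm (H.le_of_point (fun B hB => ?_) (fun B hB => ?_))
        ⟨Set.empty_subset _, Set.empty_subset _⟩
      · obtain ⟨_, X, rfl⟩ := p
        have h1 := (H.point_mem_lower B _).1 (h.1 hB.2) (H.point_mem B)
        refine absurd ((H.point_mem_upper B X).2 ?_) h1
        exact ⟨H.point B, H.point_mem B, (H.point_mem_lower B X).1 hB.1 (H.point_mem B)⟩
      · obtain ⟨h1, h2⟩ := (H.point_mem_inf_snd p q B).1 hB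
        obtain ⟨_, X, rfl⟩ := p
        obtain ⟨z, hz, hzX⟩ := (H.point_mem_upper B _).1 (h.2 h2)
        exact absurd ((H.mem_upper z X).2 ⟨B, hz, (H.point_mem_upper B X).1 h1⟩) hzX

end IrredundantCovering

/-! Prime filters carry the involution `P ↦ P.dual`, and the Kleene inequality makes each `P`
comparable with its dual, so every prime filter is either some `F ⊆ F.dual` (an element of `Lower`)
or the dual of one. Make `Lower` a graph: `F` and `G` are adjacent when `F ⊆ G.dual`. The covering
has one block per `F`, and two blocks meet exactly when the filters are adjacent. An element `x`
becomes a rough set that contains the block of `F` iff `x ∈ F` and meets it iff `x ∈ F.dual`;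
`IrredundantCovering.exists_set` supplies such a set.

Rough sets are compared at the private points of the blocks, and elements of `L` by membership in
`F` and `F.dual`, so injectivity and the lattice operations are checked filter by filter.

Regularity enters only for `*`: it gives `kneg d ≤ d` for `d = x ⊔ pcompl x`, which forces each
`F.dual` to contain `x` or `pcompl x`, as the upper approximation of the pseudocomplement requires.
-/

namespace PseudocomplementedKleeneAlgebra

variable {L : Type u} [PseudocomplementedKleeneAlgebra L]

/-! ### Negation, dense elements and regularity -/

theorem kneg_le_iff {x y : L} : kneg x ≤ y ↔ kneg y ≤ x :=
  ⟨fun h => by simpa only [kneg_kneg] using kneg_le_kneg _ _ h,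
    fun h => by simpa only [kneg_kneg] using kneg_le_kneg _ _ h⟩

theorem le_kneg_iff {x y : L} : x ≤ kneg y ↔ y ≤ kneg x :=
  ⟨fun h => by simpa only [kneg_kneg] using kneg_le_kneg _ _ h,
    fun h => by simpa only [kneg_kneg] using kneg_le_kneg _ _ h⟩

theorem kneg_sup (x y : L) : kneg (x ⊔ y) = kneg x ⊓ kneg y :=
  eq_of_forall_le_iff fun z => by
    rw [le_inf_iff, le_kneg_iff, sup_le_iff, le_kneg_iff, le_kneg_iff (x := z) (y := y)]

theorem kneg_inf (x y : L) : kneg (x ⊓ y) = kneg x ⊔ kneg y :=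
  eq_of_forall_ge_iff fun z => by
    rw [sup_le_iff, kneg_le_iff, le_inf_iff, kneg_le_iff, kneg_le_iff (x := z) (y := y)]

theorem kneg_bot : kneg (⊥ : L) = ⊤ :=
  top_le_iff.1 (le_kneg_iff.2 bot_le)

theorem kneg_top : kneg (⊤ : L) = ⊥ :=
  le_bot_iff.1 (kneg_le_iff.2 le_top)

theorem inf_pcompl (x : L) : x ⊓ pcompl x = ⊥ :=
  (inf_eq_bot_iff_le_pcompl _ _).2 le_rfl

/-- Elements of the form `x ⊔ x*` are dense. -/
theorem eq_bot_of_sup_pcompl_inf {x w : L} (h : (x ⊔ pcompl x) ⊓ w = ⊥) : w = ⊥ := by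
  rw [inf_sup_right, sup_eq_bot_iff, inf_eq_bot_iff_le_pcompl] at h
  rw [← h.2, inf_eq_right.2 h.1]

theorem pcompl_sup_eq_bot (x y : L) : pcompl (y ⊔ (x ⊔ pcompl x)) = ⊥ := by
  refine eq_bot_of_sup_pcompl_inf (x := x) (le_bot_iff.1 ?_)
  rw [← inf_pcompl (y ⊔ (x ⊔ pcompl x))]
  exact inf_le_inf_right _ le_sup_right

/-- In a regular algebra, the negation of a dense element `x ⊔ x*` lies below every element
`y ⊔ y*`. -/
theorem IsRegular.kneg_sup_pcompl_le (hL : IsRegular L) (x y : L) :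
    kneg (x ⊔ pcompl x) ≤ y ⊔ pcompl y := by
  set d := x ⊔ pcompl x with hd
  set b := y ⊔ pcompl y with hb
  have h : kneg d ⊔ b = b := by
    -- Both sides lie above the dense element `b`, so their pseudocomplements are `⊥`.
    refine hL _ _ ?_ ?_
    · rw [pcompl_sup_eq_bot]
      simpa using (pcompl_sup_eq_bot y ⊥).symm
    -- Negated, the two sides are `d ⊓ kneg b` and `kneg b`; meeting with the dense `d` does not
    -- affect what is disjoint from `kneg b`.
    · refine congrArg kneg (eq_of_forall_le_iff fun z => ?_)
      rw [← inf_eq_bot_iff_le_pcompl, ← inf_eq_bot_iff_le_pcompl, kneg_sup, kneg_kneg, inf_assoc]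
      exact ⟨eq_bot_of_sup_pcompl_inf, fun h => by rw [h, inf_bot_eq]⟩
  exact sup_eq_right.1 h

/-! ### Prime filters -/

variable (L) in
/-- Prime filters of a pseudocomplemented Kleene algebra. -/
@[ext]
structure PrimeFilter where
  carrier : Set L
  top_mem : ⊤ ∈ carrier
  bot_notMem : ⊥ ∉ carrier
  inf_mem_iff : ∀ x y, x ⊓ y ∈ carrier ↔ x ∈ carrier ∧ y ∈ carrier
  sup_mem_iff : ∀ x y, x ⊔ y ∈ carrier ↔ x ∈ carrier ∨ y ∈ carrier

namespace PrimeFilter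

theorem mem_of_le (P : PrimeFilter L) {x y : L} (h : x ≤ y) (hx : x ∈ P.carrier) :
    y ∈ P.carrier := by
  rw [← inf_eq_left.2 h, P.inf_mem_iff] at hx
  exact hx.2

/-- The complement of a prime ideal containing `y` and disjoint from the filter generated by `F` and
`x`. -/
theorem exists_of_forall_not_inf_le {F : Set L} (htop : ⊤ ∈ F)
    (hinf : ∀ a ∈ F, ∀ b ∈ F, a ⊓ b ∈ F) {x y : L} (h : ∀ f ∈ F, ¬ f ⊓ x ≤ y) :
    ∃ Q : PrimeFilter L, F ⊆ Q.carrier ∧ x ∈ Q.carrier ∧ y ∉ Q.carrier := by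
  have hG : Order.IsPFilter {z : L | ∃ f ∈ F, f ⊓ x ≤ z} := by
    refine Order.IsPFilter.of_def ⟨⊤, ⊤, htop, le_top⟩ ?_ ?_
    · rintro a ⟨f, hf, ha⟩ b ⟨f', hf', hb⟩
      refine ⟨a ⊓ b, ⟨f ⊓ f', hinf f hf f' hf', le_inf ?_ ?_⟩, inf_le_left, inf_le_right⟩
      · exact (inf_le_inf_right _ inf_le_left).trans ha
      · exact (inf_le_inf_right _ inf_le_right).trans hb
    · rintro a b hab ⟨f, hf, ha⟩
      exact ⟨f, hf, ha.trans hab⟩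
  obtain ⟨J, hJ, hyJ, hdis⟩ := DistribLattice.prime_ideal_of_disjoint_filter_ideal
    (F := hG.toPFilter) (I := Order.Ideal.principal y) (by
      rw [Set.disjoint_left]
      rintro z ⟨f, hf, hz⟩ hzy
      exact h f hf (hz.trans hzy))
  have hout : ∀ z, (∃ f ∈ F, f ⊓ x ≤ z) → z ∉ J := fun z hz => Set.disjoint_left.1 hdis hz
  refine ⟨⟨(J : Set L)ᶜ, hout _ ⟨⊤, htop, le_top⟩, fun h => h J.bot_mem, fun a b => ?_,
    fun a b => ?_⟩, fun f hf => hout f ⟨f, hf, inf_le_left⟩, hout x ⟨⊤, htop, inf_le_right⟩,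
    fun h => h (hyJ (Order.Ideal.mem_principal.2 le_rfl))⟩
  · simp only [Set.mem_compl_iff, SetLike.mem_coe, ← not_or]
    exact not_congr ⟨hJ.mem_or_mem, fun h => h.elim (J.lower inf_le_left) (J.lower inf_le_right)⟩
  · simp only [Set.mem_compl_iff, SetLike.mem_coe, Order.Ideal.sup_mem_iff, not_and_or]

/-- The involution `P ↦ {x | ∼x ∉ P}` on prime filters. -/
def dual (P : PrimeFilter L) : PrimeFilter L where
  carrier := {x | kneg x ∉ P.carrier}
  top_mem := by
    rw [Set.mem_ofPred_eq, kneg_top]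
    exact P.bot_notMem
  bot_notMem h := h (by rw [kneg_bot]; exact P.top_mem)
  inf_mem_iff x y := by
    simp only [Set.mem_ofPred_eq, kneg_inf, P.sup_mem_iff, not_or]
  sup_mem_iff x y := by
    simp only [Set.mem_ofPred_eq, kneg_sup, P.inf_mem_iff, not_and_or]

theorem mem_dual {P : PrimeFilter L} {x : L} : x ∈ P.dual.carrier ↔ kneg x ∉ P.carrier :=
  Iff.rfl

theorem dual_dual (P : PrimeFilter L) : P.dual.dual = P := by
  ext x
  simp only [mem_dual, kneg_kneg, not_not]

theorem kneg_mem_dual {P : PrimeFilter L} {x : L} : kneg x ∈ P.dual.carrier ↔ x ∉ P.carrier := by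
  rw [mem_dual, kneg_kneg]

theorem subset_dual_comm {P Q : PrimeFilter L} (h : P.carrier ⊆ Q.dual.carrier) :
    Q.carrier ⊆ P.dual.carrier :=
  fun x hx hxP => h hxP (by rwa [kneg_kneg])

/-- If `a ∈ P` is not in the dual and `b` is in the dual but not in `P`, then `P` contains `a ⊓ kneg
a` but neither `b` nor `kneg b`, against the Kleene inequality. -/
theorem subset_dual_or_dual_subset (P : PrimeFilter L) :
    P.carrier ⊆ P.dual.carrier ∨ P.dual.carrier ⊆ P.carrier := by
  by_contra! h
  obtain ⟨⟨a, ha, ha'⟩, b, hb, hb'⟩ := h.imp Set.not_subset.1 Set.not_subset.1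
  rw [mem_dual, not_not] at ha'
  have := P.mem_of_le (inf_kneg_le_sup_kneg a b) ((P.inf_mem_iff _ _).2 ⟨ha, ha'⟩)
  exact ((P.sup_mem_iff _ _).1 this).elim hb' hb

theorem not_mem_and_pcompl_mem (P : PrimeFilter L) {x : L} (h : x ∈ P.carrier)
    (h' : pcompl x ∈ P.carrier) : False :=
  P.bot_notMem (by rw [← inf_pcompl x]; exact (P.inf_mem_iff _ _).2 ⟨h, h'⟩)

variable (L) in
/-- Prime filters contained in their dual. -/
abbrev Lower : Type u := {P : PrimeFilter L // P.carrier ⊆ P.dual.carrier}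

/-- The last clause lets any prime filter be enlarged to the dual of a member of `Lower`. -/
theorem exists_lower (P : PrimeFilter L) : ∃ F : Lower L,
    (F.1 = P ∨ F.1.dual = P) ∧ P.carrier ⊆ F.1.dual.carrier := by
  rcases P.subset_dual_or_dual_subset with h | h
  · exact ⟨⟨P, h⟩, Or.inl rfl, h⟩
  · exact ⟨⟨P.dual, by rwa [dual_dual]⟩, Or.inr (dual_dual P), by rw [dual_dual]⟩

/-! ### Pseudocomplements and order seen through `Lower` -/

theorem pcompl_mem_dual_iff (hL : IsRegular L) (F : Lower L) (x : L) :
    pcompl x ∈ F.1.dual.carrier ↔ x ∉ F.1.dual.carrier := by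
  refine ⟨fun h h' => not_mem_and_pcompl_mem _ h' h, fun h => ?_⟩
  have hd : x ⊔ pcompl x ∈ F.1.dual.carrier := by
    by_contra hd
    rw [mem_dual, not_not] at hd
    -- With `d = x ⊔ pcompl x`, `kneg d ∈ F` and regularity give `d ∈ F`, whereas `F ⊆ F.dual`
    -- forbids both.
    exact F.2 hd (by rw [kneg_kneg]; exact F.1.mem_of_le (hL.kneg_sup_pcompl_le x x) hd)
  exact ((sup_mem_iff _ _ _).1 hd).resolve_left h

/-- If `pcompl x ∉ F`, the filter generated by `F` and `x` is proper, hence extends to a prime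
filter and then to some `G.dual`. Regularity plays no role. -/
theorem pcompl_mem_iff (F : Lower L) (x : L) :
    pcompl x ∈ F.1.carrier ↔
      ∀ G : Lower L, F.1.carrier ⊆ G.1.dual.carrier → x ∉ G.1.dual.carrier := by
  refine ⟨fun h G hFG hx => not_mem_and_pcompl_mem _ hx (hFG h), fun h => ?_⟩
  by_contra hx
  obtain ⟨Q, hFQ, hxQ, -⟩ := exists_of_forall_not_inf_le (x := x) (y := ⊥) F.1.top_mem
    (fun a ha b hb => (F.1.inf_mem_iff a b).2 ⟨ha, hb⟩) (fun f hf hfx => hx <|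
      F.1.mem_of_le ((inf_eq_bot_iff_le_pcompl x f).1 (by rwa [inf_comm, ← le_bot_iff])) hf)
  obtain ⟨G, -, hG⟩ := Q.exists_lower
  exact h G (hFQ.trans hG) (hG hxQ)

theorem le_of_lower {x y : L} (h : ∀ F : Lower L, x ∈ F.1.carrier → y ∈ F.1.carrier)
    (h' : ∀ F : Lower L, x ∈ F.1.dual.carrier → y ∈ F.1.dual.carrier) : x ≤ y := by
  by_contra hxy
  obtain ⟨Q, -, hx, hy⟩ := exists_of_forall_not_inf_le (F := {⊤}) (x := x) (y := y) rfl
    (by simp) (by simpa using hxy)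
  obtain ⟨F, rfl | rfl, -⟩ := Q.exists_lower
  · exact hy (h F hx)
  · exact hy (h' F hx)

/-! ### The covering associated with the prime filters -/

variable (L) in
/-- Pairs of comparable prime filters the smaller of which is contained in its dual. -/
abbrev Pair : Type u := {p : Lower L × PrimeFilter L // p.1.1.carrier ⊆ p.2.carrier}

/-- The pairs whose first member or whose dualized second member is `F`. -/
def block (F : Lower L) : Set (Pair L) := {p | p.1.1 = F ∨ p.1.2.dual = F.1}

/-- The pair of `F` and its dual, which belongs to `block F` only. -/
def dualPair (F : Lower L) : Pair L := ⟨(F, F.1.dual), F.2⟩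

theorem dualPair_mem_block {F G : Lower L} : dualPair F ∈ block G ↔ F = G := by
  refine ⟨?_, fun h => Or.inl h⟩
  rintro (h | h)
  · exact h
  · exact Subtype.ext ((dual_dual _).symm.trans h)

theorem block_injective : Function.Injective (block (L := L)) :=
  fun F _ h => dualPair_mem_block.1 (h ▸ dualPair_mem_block.2 (rfl : F = F))

theorem block_inter_nonempty {F G : Lower L} :
    (block F ∩ block G).Nonempty ↔ F.1.carrier ⊆ G.1.dual.carrier := by
  constructor
  · rintro ⟨⟨⟨P, Q⟩, hPQ⟩, hF, hG⟩
    simp only [block, Set.mem_ofPred_eq] at hF hG hPQ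
    rcases hF with rfl | hF <;> rcases hG with rfl | hG
    · exact P.2
    · rwa [← hG, dual_dual]
    · refine subset_dual_comm ?_
      rwa [← hF, dual_dual]
    -- Both memberships come from the second coordinate, so `F = G`.
    · rw [← hF, Subtype.ext (hG.symm.trans hF)]
      simpa only [hF] using F.2
  · exact fun h => ⟨⟨(F, G.1.dual), h⟩, Or.inl rfl, Or.inr (dual_dual _)⟩

/-- The block always holds `(F, F.dual)` and `(F, F)`. Pairs such as `(F, F)` are admitted so that a
one-point block, which cannot be met without being contained, arises only for self-dual `F`. -/
theorem dual_eq_of_block_subsingleton {F : Lower L} (h : (block F).Subsingleton) :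
    F.1.dual = F.1 :=
  congrArg (fun p : Pair L => p.1.2) (h (x := dualPair F) (Or.inl rfl)
    (y := ⟨(F, F.1), subset_rfl⟩) (Or.inl rfl))

variable (L) in
/-- The irredundant covering by the blocks of the prime filters contained in their duals. -/
def covering : IrredundantCovering (Pair L) where
  sets := Set.range block
  isCovering := by
    refine ⟨?_, Set.eq_univ_iff_forall.2 fun p => ⟨_, ⟨p.1.1, rfl⟩, Or.inl rfl⟩⟩
    rintro _ ⟨F, rfl⟩
    exact ⟨dualPair F, Or.inl rfl⟩
  irredundant := by
    rintro _ ⟨F, rfl⟩ h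
    obtain ⟨_, ⟨⟨G, rfl⟩, hne⟩, hG⟩ := Set.eq_univ_iff_forall.1 h.2 (dualPair F)
    exact hne (congrArg block (dualPair_mem_block.1 hG).symm)

/-- The block of `F` as a member of the covering. -/
def blockSet (F : Lower L) : (covering L).sets := ⟨block F, F, rfl⟩

/-! ### The representation of elements by rough sets -/

theorem exists_roughSet (x : L) : ∃ X : Set (Pair L), ∀ F : Lower L,
    (block F ⊆ X ↔ x ∈ F.1.carrier) ∧ ((block F ∩ X).Nonempty ↔ x ∈ F.1.dual.carrier) := by
  obtain ⟨X, hX⟩ := (covering L).exists_set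
    -- The two compatibility conditions are `F ⊆ G.dual` for blocks that meet and `F.dual = F` for
    -- singleton blocks.
    {B | ∃ F : Lower L, blockSet F = B ∧ x ∈ F.1.carrier}
    {B | ∃ F : Lower L, blockSet F = B ∧ x ∈ F.1.dual.carrier} (by
      rintro _ ⟨F, rfl, hx⟩ ⟨_, G, rfl⟩ hFG
      exact ⟨G, rfl, block_inter_nonempty.1 hFG hx⟩) (by
      rintro _ ⟨F, rfl, hx⟩ hs
      exact ⟨F, rfl, by rwa [dual_eq_of_block_subsingleton hs] at hx⟩)
  have hinj : ∀ F G : Lower L, blockSet F = blockSet G → F = G :=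
    fun F G h => block_injective (congrArg Subtype.val h)
  refine ⟨X, fun F => ⟨(hX (blockSet F)).1.trans ⟨?_, fun h => ⟨F, rfl, h⟩⟩,
    (hX (blockSet F)).2.trans ⟨?_, fun h => ⟨F, rfl, h⟩⟩⟩⟩
  · rintro ⟨G, hG, h⟩
    exact hinj _ _ hG ▸ h
  · rintro ⟨G, hG, h⟩
    exact hinj _ _ hG ▸ h

/-- The rough set representing an element. -/
noncomputable def rep (x : L) : RoughSet (covering L).tolerance :=
  ⟨_, (exists_roughSet x).choose, rfl⟩

theorem point_mem_rep_fst (x : L) (F : Lower L) :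
    (covering L).point (blockSet F) ∈ (rep x).1.1 ↔ x ∈ F.1.carrier :=
  ((covering L).point_mem_lower _ _).trans ((exists_roughSet x).choose_spec F).1

theorem point_mem_rep_snd (x : L) (F : Lower L) :
    (covering L).point (blockSet F) ∈ (rep x).1.2 ↔ x ∈ F.1.dual.carrier :=
  ((covering L).point_mem_upper _ _).trans ((exists_roughSet x).choose_spec F).2

/-- Needed at arbitrary pairs, not only private points: the approximations defining `*` range over
whole blocks. -/
theorem mem_rep_snd (x : L) (p : Pair L) :
    p ∈ (rep x).1.2 ↔ ∃ F : Lower L, p ∈ block F ∧ x ∈ F.1.dual.carrier := by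
  refine ((covering L).mem_upper _ _).trans ⟨?_, ?_⟩
  · rintro ⟨⟨_, F, rfl⟩, hp, h⟩
    exact ⟨F, hp, ((exists_roughSet x).choose_spec F).2.1 h⟩
  · rintro ⟨F, hp, h⟩
    exact ⟨blockSet F, hp, ((exists_roughSet x).choose_spec F).2.2 h⟩

theorem roughSet_ext {p q : RoughSet (covering L).tolerance}
    (h : ∀ F, (covering L).point (blockSet F) ∈ p.1.1 ↔ (covering L).point (blockSet F) ∈ q.1.1)
    (h' : ∀ F, (covering L).point (blockSet F) ∈ p.1.2 ↔ (covering L).point (blockSet F) ∈ q.1.2) :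
    p = q := by
  refine le_antisymm ((covering L).le_of_point ?_ ?_) ((covering L).le_of_point ?_ ?_) <;>
    rintro ⟨_, F, rfl⟩
  exacts [(h F).1, (h' F).1, (h F).2, (h' F).2]

theorem rep_injective : Function.Injective (rep (L := L)) := by
  intro x y h
  refine le_antisymm (le_of_lower ?_ ?_) (le_of_lower ?_ ?_) <;> intro F <;>
    simp only [← point_mem_rep_fst, ← point_mem_rep_snd, h] <;> exact id

theorem rep_sup (x y : L) : rep (x ⊔ y) = rep x ⊔ rep y := by
  refine roughSet_ext (fun F => ?_) fun F => ?_
  · rw [IrredundantCovering.point_mem_sup_fst]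
    simp only [point_mem_rep_fst, sup_mem_iff]
  · rw [point_mem_rep_snd, sup_mem_iff, ← point_mem_rep_snd, ← point_mem_rep_snd]
    rfl

theorem rep_inf (x y : L) : rep (x ⊓ y) = rep x ⊓ rep y := by
  refine roughSet_ext (fun F => ?_) fun F => ?_
  · rw [point_mem_rep_fst, inf_mem_iff, ← point_mem_rep_fst, ← point_mem_rep_fst]
    rfl
  · rw [IrredundantCovering.point_mem_inf_snd]
    simp only [point_mem_rep_snd, inf_mem_iff]

theorem rep_kneg (x : L) : rep (kneg x) = kneg (rep x) := by
  refine roughSet_ext (fun F => ?_) fun F => ?_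
  · refine (point_mem_rep_fst _ F).trans (Iff.trans ?_ (not_congr (point_mem_rep_snd x F)).symm)
    rw [mem_dual, not_not]
  · exact (point_mem_rep_snd _ F).trans
      (kneg_mem_dual.trans (not_congr (point_mem_rep_fst x F)).symm)

theorem rep_pcompl (hL : IsRegular L) (x : L) : rep (pcompl x) = pcompl (rep x) := by
  refine roughSet_ext (fun F => ?_) fun F => ?_
  -- The block of `F` avoids the upper approximation iff no adjacent `G` has `x ∈ G.dual`.
  · refine (point_mem_rep_fst _ F).trans ((pcompl_mem_iff F x).trans (Iff.trans ?_
      ((covering L).point_mem_lower (blockSet F) (rep x).1.2ᶜ).symm))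
    constructor
    · intro h p hp hpx
      obtain ⟨G, hG, hx⟩ := (mem_rep_snd x p).1 hpx
      exact h G (block_inter_nonempty.1 ⟨p, hp, hG⟩) hx
    · intro h G hFG hx
      obtain ⟨p, hpF, hpG⟩ := block_inter_nonempty.2 hFG
      exact h hpF ((mem_rep_snd x p).2 ⟨G, hpG, hx⟩)
  · refine (point_mem_rep_snd _ F).trans ((pcompl_mem_dual_iff hL F x).trans (Iff.trans ?_
      ((covering L).point_mem_upper (blockSet F) (rep x).1.2ᶜ).symm))
    constructor
    -- The private point suffices, since it sees only the block of `F`.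
    · exact fun h => ⟨_, (covering L).point_mem (blockSet F),
        fun h' => h ((point_mem_rep_snd x F).1 h')⟩
    · rintro ⟨p, hp, hpx⟩ hx
      exact hpx ((mem_rep_snd x p).2 ⟨F, hp, hx⟩)

theorem rep_bot : rep (⊥ : L) = ⊥ :=
  roughSet_ext (fun F => iff_of_false (fun h => F.1.bot_notMem ((point_mem_rep_fst _ F).1 h)) id)
    fun F => iff_of_false (fun h => F.1.dual.bot_notMem ((point_mem_rep_snd _ F).1 h)) id

theorem rep_top : rep (⊤ : L) = ⊤ :=
  roughSet_ext (fun F => iff_of_true ((point_mem_rep_fst _ F).2 F.1.top_mem) trivial)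
    fun F => iff_of_true ((point_mem_rep_snd _ F).2 F.1.dual.top_mem) trivial

end PrimeFilter

end PseudocomplementedKleeneAlgebra

open PseudocomplementedKleeneAlgebra PrimeFilter in
theorem theorem3p7 (L : Type u) [PseudocomplementedKleeneAlgebra L]
    (hL : PseudocomplementedKleeneAlgebra.IsRegular L) :
    ∃ (U : Type u) (H : IrredundantCovering U) (S : Set (RoughSet H.tolerance)),
      PseudocomplementedKleeneAlgebra.IsSubalgebra S ∧
        ∃ e : L ≃ S, PseudocomplementedKleeneAlgebra.IsIsomorphismOnto e := by
  refine ⟨Pair L, covering L, Set.range rep, ?_, Equiv.ofInjective rep rep_injective,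
    rep_sup, rep_inf, rep_kneg, rep_pcompl hL, rep_bot, rep_top⟩
  constructor
  · rintro _ ⟨x, rfl⟩ _ ⟨y, rfl⟩
    exact ⟨x ⊔ y, rep_sup x y⟩
  · rintro _ ⟨x, rfl⟩ _ ⟨y, rfl⟩
    exact ⟨x ⊓ y, rep_inf x y⟩
  · rintro _ ⟨x, rfl⟩
    exact ⟨kneg x, rep_kneg x⟩
  · rintro _ ⟨x, rfl⟩
    exact ⟨pcompl x, rep_pcompl hL x⟩
  · exact ⟨⊥, rep_bot⟩
  · exact ⟨⊤, rep_top⟩
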